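/- Let $D>1$ be a square-free integer, let $\mathcal O_D$ be the ring of integers of $\mathbb Q(\sqrt D)\subset\mathbb R$, and let $\varepsilon>1$ be the fundamental unit of $\mathcal O_D$. Assume that $N(\varepsilon)=-1$. Put $q=D$ if $D\equiv 1 \pmod 4$ and $q=4D$ otherwise, let $F_D(n)=\operatorname{Tr}_{\mathbb Q(\sqrt D)/\mathbb Q}(\varepsilon^n/\sqrt q)$, and for $\operatorname{Re} s>0$ let $$Z_D^{\mathrm{odd}}(s)=\sum_{n\ge 1}\frac{1}{F_D(2n-1)^s},$$ a series which converges absolutely. Let $P=\{-2k+\frac{\pi i m}{\log\varepsilon} : k\in\mathbb Z_{\ge 0},\ m\in\mathbb Z\}$. Then $Z_D^{\mathrm{odd}}$ has a meromorphic continuation to $\mathbb C$. The continuation is holomorphic on $\mathbb C\setminus P$ and has a simple pole at every point of $P$, and for every $s\in\mathbb C\setminus P$ it is given by $$Z_D^{\mathrm{odd}}(s)=\frac{q^{s/2}}{8\,\Gamma(s)\log\varepsilon}\sum_{m\in\mathbb Z}(-1)^m\,\Gamma\Big(\frac s2+\frac{\pi i m}{2\log\varepsilon}\Big)\Gamma\Big(\frac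 s2-\frac{\pi i m}{2\log\varepsilon}\Big),$$ where the sum over $m$ converges absolutely and $1/\Gamma(s)$ denotes the entire function, equal to $0$ at the non-positive integers. -/

import Mathlib

open scoped NumberField

noncomputable section

/-- The field `ℚ(√D)`, as a subfield of `ℝ`. -/
abbrev QSqrt (D : ℕ) : IntermediateField ℚ ℝ :=
  IntermediateField.adjoin ℚ {Real.sqrt (D : ℝ)}

/-- The integer `q`, equal to `D` if `D ≡ 1 mod 4` and to `4D` otherwise. -/
def qOf (D : ℕ) : ℕ := if D % 4 = 1 then D else 4 * D

theorem sqrt_qOf_mem (D : ℕ) : Real.sqrt (qOf D : ℝ) ∈ QSqrt D := by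
  have h : Real.sqrt (D : ℝ) ∈ QSqrt D :=
    IntermediateField.subset_adjoin ℚ _ (Set.mem_singleton _)
  unfold qOf
  split_ifs
  · exact h
  · have h4 : Real.sqrt ((4 * D : ℕ) : ℝ) = Real.sqrt (D : ℝ) + Real.sqrt (D : ℝ) := by
      push_cast
      rw [Real.sqrt_mul (by norm_num), show (4 : ℝ) = 2 ^ 2 by norm_num,
        Real.sqrt_sq (by norm_num)]
      ring
    rw [h4]
    exact add_mem h h

/-- The positive square root `√q`, as an element of `ℚ(√D)`. -/
def sqrtQ (D : ℕ) : QSqrt D := ⟨Real.sqrt (qOf D : ℝ), sqrt_qOf_mem D⟩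

/-- A unit of the ring of integers of `ℚ(√D)`, as an element of the field. -/
def unitToField {D : ℕ} (ε : (𝓞 (QSqrt D))ˣ) : QSqrt D :=
  algebraMap (𝓞 (QSqrt D)) (QSqrt D) ε

/-- A unit of the ring of integers of `ℚ(√D) ⊂ ℝ`, as a real number. -/
def unitToReal {D : ℕ} (ε : (𝓞 (QSqrt D))ˣ) : ℝ := (unitToField ε : ℝ)

/-- `ε` is the fundamental unit: `ε > 1`, and every unit is `± ε ^ n` for an integer `n`. -/
def IsFundamentalUnit {D : ℕ} (ε : (𝓞 (QSqrt D))ˣ) : Prop :=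
  1 < unitToReal ε ∧ ∀ u : (𝓞 (QSqrt D))ˣ, ∃ n : ℤ, u = ε ^ n ∨ u = -ε ^ n

/-- The `𝒪_D` Fibonacci number `F_D(n) = Tr(ε ^ n / √q)`. -/
def fibD {D : ℕ} (ε : (𝓞 (QSqrt D))ˣ) (n : ℕ) : ℚ :=
  Algebra.trace ℚ (QSqrt D) (unitToField ε ^ n / sqrtQ D)

/-- The terms of the odd-indexed zeta series. The `n`-th term, `n ≥ 0`, has index `2n + 1`, so
that the index runs over `1, 3, 5, …`. -/
def oddZetaTerm {D : ℕ} (ε : (𝓞 (QSqrt D))ˣ) (s : ℂ) (n : ℕ) : ℂ :=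
  1 / ((fibD ε (2 * n + 1) : ℚ) : ℂ) ^ s

/-- The odd-indexed zeta function, as a series (which converges for `Re s > 0`). -/
def oddZetaSeries {D : ℕ} (ε : (𝓞 (QSqrt D))ˣ) (s : ℂ) : ℂ :=
  ∑' n : ℕ, oddZetaTerm ε s n

/-- The summand with index `m`. -/
def gammaTerm {D : ℕ} (ε : (𝓞 (QSqrt D))ˣ) (s : ℂ) (m : ℤ) : ℂ :=
  (-1 : ℂ) ^ m
    * Complex.Gamma (s / 2 + Real.pi * Complex.I * m / (2 * (Real.log (unitToReal ε) : ℂ)))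
    * Complex.Gamma (s / 2 - Real.pi * Complex.I * m / (2 * (Real.log (unitToReal ε) : ℂ)))

/-- The points `-2k + πim / log ε` with `k ≥ 0` and `m` integers. These are exactly the points
where one of the functions `s ↦ gammaTerm ε s m` has a pole. -/
def poleSet {D : ℕ} (ε : (𝓞 (QSqrt D))ˣ) : Set ℂ :=
  {s | ∃ (k : ℕ) (m : ℤ),
    s = -2 * (k : ℂ) + Real.pi * Complex.I * m / (Real.log (unitToReal ε) : ℂ)}

end

/-! Since `ε` has norm `-1`, its conjugate is `-1/ε`, so for odd `k` the trace `Tr(ε ^ k / √q)`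
equals `2 cosh (k L) / √q` with `L = log ε` (`fibD_odd`). The series is therefore `q ^ (s/2)` times
the sum over `n ≥ 0` of `(2 cosh (L (2n+1))) ^ (-s)`. The summand is invariant under `n ↦ -n-1`, so
this is half of a sum over `ℤ`, to which Poisson summation applies (`tsum_sechPow`). A sigmoid
substitution identifies the Fourier transform with a Beta integral, that is, a product of two Gamma
values over `Γ(s)` (`fourier_sechPow`); the sign `(-1) ^ m` comes from the half-integer shift in
`2x+1 = 2(x + 1/2)`.

The Gamma side makes sense for every `s`: the functional equation gives polynomial decay of `Γ`
along vertical lines, so near any point all but finitely many terms form a locally uniformly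
convergent analytic tail (`exists_gammaPair_tail`). At a candidate pole only the terms `m` and `-m`
are singular. If `m ≠ 0` they are equal, each with a simple pole, and do not cancel; if `m = 0` the
double pole of `Γ(s/2)²` meets the simple zero of `1/Γ(s)`. Every pole is thus simple
(`meromorphicOrderAt_one_div_Gamma_mul_tsum`). -/

section GammaSeries

open Complex Filter Topology

/-! ### Vertical decay of Gamma and convergence of the Gamma series. -/

theorem norm_Gamma_le_Gamma_re {z : ℂ} (hz : 0 < z.re) : ‖Gamma z‖ ≤ Real.Gamma z.re := by
  rw [Gamma_eq_integral hz, Real.Gamma_eq_integral hz, GammaIntegral]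
  refine (MeasureTheory.norm_integral_le_integral_norm _).trans_eq ?_
  refine MeasureTheory.setIntegral_congr_fun measurableSet_Ioi fun x hx => ?_
  have hx' : (0 : ℝ) < x := hx
  simp [Complex.norm_cpow_eq_rpow_re_of_pos hx', Complex.norm_exp]

/-- `Γ(z + n) = z (z + 1) ⋯ (z + n - 1) Γ(z)`, and each of the `n` factors has modulus at least `|Im
z|`. -/
theorem norm_Gamma_mul_abs_im_pow_le (n : ℕ) (z : ℂ) (hz : z.im ≠ 0) (h : 0 < z.re + n) :
    ‖Gamma z‖ * |z.im| ^ n ≤ Real.Gamma (z.re + n) := by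
  induction n generalizing z with
  | zero => simpa using norm_Gamma_le_Gamma_re (by simpa using h)
  | succ n ih =>
    have hz0 : z ≠ 0 := by rintro rfl; simp at hz
    have h1 := ih (z + 1) (by simpa using hz) (by push_cast at h; simp; linarith)
    rw [Gamma_add_one z hz0, norm_mul] at h1
    have h2 : z.re + ((n + 1 : ℕ) : ℝ) = (z + 1).re + n := by push_cast; simp; ring
    rw [h2]
    refine le_trans ?_ h1
    have h3 : |z.im| ≤ ‖z‖ := abs_im_le_norm z
    have h4 : (z + 1).im = z.im := by simp
    rw [h4, pow_succ]
    calc ‖Gamma z‖ * (|z.im| ^ n * |z.im|) = |z.im| * ‖Gamma z‖ * |z.im| ^ n := by ring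
      _ ≤ _ := by gcongr

/-- The summand `(-1) ^ m Γ(s / 2 + i a m) Γ(s / 2 - i a m)`. -/
noncomputable def gammaPair (a : ℝ) (m : ℤ) (s : ℂ) : ℂ :=
  (-1 : ℂ) ^ m * Gamma (s / 2 + (a * m : ℝ) * I) * Gamma (s / 2 - (a * m : ℝ) * I)

theorem gammaPair_neg (a : ℝ) (m : ℤ) (s : ℂ) : gammaPair a (-m) s = gammaPair a m s := by
  unfold gammaPair
  have h : (-1 : ℂ) ^ (-m) = (-1) ^ m := by
    rw [zpow_neg, ← inv_zpow, inv_neg, inv_one]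
  rw [h]
  push_cast
  rw [mul_right_comm]
  congr 3 <;> ring

theorem norm_negOne_zpow (m : ℤ) : ‖(-1 : ℂ) ^ m‖ = 1 := by simp

theorem exists_norm_Gamma_le (a : ℝ) (ha : 0 < a) (s₀ : ℂ) :
    ∃ (p : ℕ) (C B : ℝ), 1 ≤ p ∧ 0 ≤ C ∧ ∀ (t : ℝ), B ≤ |t| → ∀ s ∈ Metric.ball s₀ 1,
      (s / 2 + (a * t : ℝ) * I).im ≠ 0 ∧
      ‖Gamma (s / 2 + (a * t : ℝ) * I)‖ ≤ C / |t| ^ p := by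
  obtain ⟨n, hn⟩ := exists_nat_ge (|s₀.re| + 3)
  have hn1 : 1 ≤ n := by
    have : (1 : ℝ) ≤ n := by linarith [abs_nonneg s₀.re]
    exact_mod_cast this
  have hcont : ContinuousOn Real.Gamma (Set.Icc 1 (2 * (n : ℝ))) := fun x hx =>
    (Real.differentiableAt_Gamma fun m => by
      have := hx.1
      have hm : (0 : ℝ) ≤ m := m.cast_nonneg
      intro h; linarith).continuousAt.continuousWithinAt
  obtain ⟨M, hM⟩ := isCompact_Icc.exists_bound_of_continuousOn hcont
  have hM0 : 0 ≤ M := by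
    refine (norm_nonneg _).trans (hM 1 ⟨le_rfl, ?_⟩)
    have : (1 : ℝ) ≤ n := by exact_mod_cast hn1
    linarith
  -- The threshold on `|t|` makes `|Im s / 2|` at most half of `a |t|` on the ball, hence `|Im z| ≥
  -- a |t| / 2`; the choice of `n` keeps `Re z + n` in `[1, 2n]`, where `M` bounds `Γ`.
  refine ⟨n, M / (a / 2) ^ n, (|s₀.im| + 1) / a, hn1, by positivity, fun t ht s hs => ?_⟩
  have hd : ‖s - s₀‖ < 1 := by simpa [dist_eq_norm] using hs
  have hre : |s.re - s₀.re| < 1 := by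
    simpa using (abs_re_le_norm (s - s₀)).trans_lt hd
  have him : |s.im - s₀.im| < 1 := by
    simpa using (abs_im_le_norm (s - s₀)).trans_lt hd
  set z := s / 2 + (a * t : ℝ) * I with hz
  have hzre : z.re = s.re / 2 := by
    simp [hz]
  have hzim : z.im = s.im / 2 + a * t := by
    simp [hz]
  have hB : |s₀.im| + 1 ≤ a * |t| := by
    rw [div_le_iff₀ ha] at ht; linarith
  have hat : |a * t| = a * |t| := by rw [abs_mul, abs_of_pos ha]
  have hlow : a / 2 * |t| ≤ |z.im| := by
    rw [hzim]
    have h1 : |a * t| ≤ |s.im / 2 + a * t| + |s.im / 2| := by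
      have := abs_sub (s.im / 2 + a * t) (s.im / 2)
      simpa using this
    have h2 : |s.im / 2| = |s.im| / 2 := by rw [abs_div]; norm_num
    have h3 : |s.im| ≤ |s₀.im| + 1 := by
      have := abs_sub_abs_le_abs_sub s.im s₀.im
      linarith
    linarith
  have hat0 : 0 < a * |t| := by linarith [abs_nonneg s₀.im]
  have ht0 : 0 < |t| := by
    by_contra! h
    nlinarith
  have hne : z.im ≠ 0 := by
    intro h0
    rw [h0, abs_zero] at hlow
    linarith
  refine ⟨hne, ?_⟩
  have hre' := abs_lt.1 hre
  have hr0 := abs_le.1 (le_refl |s₀.re|)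
  have hx : z.re + n ∈ Set.Icc 1 (2 * (n : ℝ)) := by
    rw [hzre]; constructor <;> linarith [hre'.1, hre'.2, hr0.1, hr0.2]
  have h1 := norm_Gamma_mul_abs_im_pow_le n z hne (by linarith [hx.1])
  have h2 := (le_abs_self _).trans (hM _ hx)
  rw [div_div, ← mul_pow, le_div_iff₀ (by positivity)]
  calc _ ≤ ‖Gamma z‖ * |z.im| ^ n := by gcongr
    _ ≤ _ := h1.trans h2

theorem exists_gammaPair_bound (a : ℝ) (ha : 0 < a) (s₀ : ℂ) :
    ∃ (u : ℤ → ℝ) (S : Finset ℤ), Summable u ∧ ∀ m ∉ S, ∀ s ∈ Metric.ball s₀ 1,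
      DifferentiableAt ℂ (gammaPair a m) s ∧ ‖gammaPair a m s‖ ≤ u m := by
  obtain ⟨p, C, B, hp, hC, h⟩ := exists_norm_Gamma_le a ha s₀
  obtain ⟨N, hN⟩ := exists_nat_ge B
  refine ⟨fun m => C ^ 2 * (1 / (m : ℝ) ^ (2 * p)), Finset.Icc (-N : ℤ) N, ?_, ?_⟩
  · exact (Real.summable_one_div_int_pow.2 (by omega)).mul_left _
  intro m hm s hs
  have hm' : (N : ℤ) ≤ |m| := by
    by_contra! hlt
    exact hm (Finset.mem_Icc.2 (abs_le.1 hlt.le))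
  have hmB : B ≤ |(m : ℝ)| := hN.trans (by exact_mod_cast hm')
  obtain ⟨h1, h2⟩ := h m hmB s hs
  obtain ⟨h3, h4⟩ := h (-m) (by rwa [abs_neg]) s hs
  have e : s / 2 + (a * (-m : ℝ) : ℝ) * I = s / 2 - (a * m : ℝ) * I := by push_cast; ring
  rw [e] at h3 h4
  have hd : ∀ z : ℂ, z.im ≠ 0 → DifferentiableAt ℂ Gamma z := fun z hz =>
    differentiableAt_Gamma z fun k hk => hz (by rw [hk]; simp)
  constructor
  · unfold gammaPair
    refine ((differentiableAt_const _).mul ?_).mul ?_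
    · exact (hd _ h1).comp s (f := fun s : ℂ => s / 2 + (a * m : ℝ) * I) (by fun_prop)
    · exact (hd _ h3).comp s (f := fun s : ℂ => s / 2 - (a * m : ℝ) * I) (by fun_prop)
  · rw [gammaPair, norm_mul, norm_mul, norm_negOne_zpow, one_mul]
    rw [abs_neg] at h4
    calc _ ≤ (C / |(m : ℝ)| ^ p) * (C / |(m : ℝ)| ^ p) := by gcongr
      _ = _ := by
        have hsq : (m : ℝ) ^ (2 * p) = |(m : ℝ)| ^ p * |(m : ℝ)| ^ p := by
          rw [pow_mul, ← sq_abs, ← pow_mul, two_mul, pow_add]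
        simp only [hsq]
        ring

/-- The freedom to enlarge `S` allows prescribed singular indices to be moved into the finite part.
-/
theorem exists_gammaPair_tail (a : ℝ) (ha : 0 < a) (s₀ : ℂ) :
    ∃ S : Finset ℤ, ∀ S', S ⊆ S' → ∃ T : ℂ → ℂ, AnalyticAt ℂ T s₀ ∧
      ∀ᶠ s in 𝓝 s₀, Summable (fun m => gammaPair a m s) ∧
        ∑' m, gammaPair a m s = ∑ m ∈ S', gammaPair a m s + T s := by
  obtain ⟨u, S, hu, h⟩ := exists_gammaPair_bound a ha s₀
  refine ⟨S, fun S' hS => ⟨fun s => ∑' m : {m // m ∉ S'}, gammaPair a m s, ?_, ?_⟩⟩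
  · refine DifferentiableOn.analyticAt (s := Metric.ball s₀ 1) ?_
      (Metric.ball_mem_nhds _ one_pos)
    refine Complex.differentiableOn_tsum_of_summable_norm (u := fun m : {m // m ∉ S'} => u m)
      (hu.subtype _) ?_ Metric.isOpen_ball ?_
    · exact fun m s hs => (h m (fun hm => m.2 (hS hm)) s hs).1.differentiableWithinAt
    · exact fun m s hs => (h m (fun hm => m.2 (hS hm)) s hs).2
  · filter_upwards [Metric.ball_mem_nhds s₀ one_pos] with s hs
    have hsum : Summable fun m => gammaPair a m s := by
      rw [← S'.summable_compl_iff]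
      exact Summable.of_norm_bounded (g := fun m : {m // m ∉ S'} => u m) (hu.subtype _)
        fun m => (h m (fun hm => m.2 (hS hm)) s hs).2
    exact ⟨hsum, (hsum.sum_add_tsum_subtype_compl S').symm⟩

/-! ### Poles of Gamma and of the Gamma series. -/

theorem analyticAt_Gamma {z : ℂ} (hz : ∀ k : ℕ, z ≠ -k) : AnalyticAt ℂ Gamma z := by
  have hop : IsOpen {w : ℂ | (Gamma w)⁻¹ ≠ 0} :=
    isOpen_ne_fun differentiable_one_div_Gamma.continuous continuous_const
  have hmem : z ∈ {w : ℂ | (Gamma w)⁻¹ ≠ 0} := inv_ne_zero (Gamma_ne_zero hz)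
  have h := (differentiable_one_div_Gamma.analyticAt z).inv hmem
  refine h.congr (Eventually.of_forall fun w => ?_)
  simp

theorem analyticAt_one_div_Gamma (z : ℂ) : AnalyticAt ℂ (fun s => (Gamma s)⁻¹) z :=
  differentiable_one_div_Gamma.analyticAt z

theorem meromorphicAt_Gamma (z : ℂ) : MeromorphicAt Gamma z := by
  have h := (analyticAt_one_div_Gamma z).meromorphicAt.inv
  have e : (fun s => (Gamma s)⁻¹)⁻¹ = Gamma := by ext; simp
  rwa [e] at h

theorem meromorphicOrderAt_Gamma_neg_nat (k : ℕ) :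
    meromorphicOrderAt Gamma (-k : ℂ) = ((-1 : ℤ) : WithTop ℤ) := by
  induction k with
  | zero =>
    rw [meromorphicOrderAt_eq_int_iff (meromorphicAt_Gamma _)]
    refine ⟨fun z => Gamma (z + 1), ?_, by simp, ?_⟩
    · have h1 : AnalyticAt ℂ Gamma ((-(0 : ℕ) : ℂ) + 1) :=
        analyticAt_Gamma fun k hk => by
          have : ((k + 1 : ℕ) : ℂ) = 0 := by push_cast at hk ⊢; linear_combination hk
          exact Nat.succ_ne_zero k (by exact_mod_cast this)
      exact h1.comp_of_eq (f := fun z : ℂ => z + 1) (by fun_prop) rfl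
    · filter_upwards [self_mem_nhdsWithin] with z hz
      have hz0 : z ≠ 0 := by simpa using hz
      rw [Gamma_add_one z hz0]
      simp
      field_simp
  | succ k ih =>
    have hne : (-((k + 1 : ℕ) : ℂ)) ≠ 0 := by
      rw [neg_ne_zero]; exact_mod_cast Nat.succ_ne_zero k
    have h1 : Gamma =ᶠ[𝓝[≠] (-((k + 1 : ℕ) : ℂ))] (fun z => z⁻¹) * (Gamma ∘ (· + 1)) := by
      filter_upwards [(isOpen_ne.mem_nhds hne |> mem_nhdsWithin_of_mem_nhds)] with z hz
      have hz0 : z ≠ 0 := hz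
      simp only [Pi.mul_apply, Function.comp_apply]
      rw [Gamma_add_one z hz0]
      field_simp
    rw [meromorphicOrderAt_congr h1, meromorphicOrderAt_mul_of_ne_zero
      (analyticAt_inv hne) (inv_ne_zero hne),
      meromorphicOrderAt_comp_add_const_eq_meromorphicOrderAt, ← ih]
    congr 1
    push_cast; ring

theorem meromorphicOrderAt_Gamma_half_add (c s₀ : ℂ) (k : ℕ) (h : s₀ / 2 + c = -k) :
    meromorphicOrderAt (fun s => Gamma (s / 2 + c)) s₀ = ((-1 : ℤ) : WithTop ℤ) := by
  have hd : HasDerivAt (fun s : ℂ => s / 2 + c) (1 / 2) s₀ :=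
    ((hasDerivAt_id s₀).div_const 2).add_const c
  have := meromorphicOrderAt_comp_of_deriv_ne_zero (f := Gamma)
    (g := fun s : ℂ => s / 2 + c) (x := s₀) (by fun_prop) (by rw [hd.deriv]; norm_num)
  rw [h, meromorphicOrderAt_Gamma_neg_nat] at this
  exact this

theorem analyticAt_Gamma_half_add {c s₀ : ℂ} (h : ∀ k : ℕ, s₀ / 2 + c ≠ -k) :
    AnalyticAt ℂ (fun s => Gamma (s / 2 + c)) s₀ :=
  (analyticAt_Gamma h).comp_of_eq (f := fun s : ℂ => s / 2 + c) (by fun_prop) rfl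

theorem gammaPair_eq (a : ℝ) (m : ℤ) :
    gammaPair a m = fun s => (-1 : ℂ) ^ m * Gamma (s / 2 + (a * m : ℝ) * I) *
      Gamma (s / 2 + -((a * m : ℝ) * I)) := rfl

theorem analyticAt_gammaPair {a : ℝ} {m : ℤ} {s₀ : ℂ}
    (h : ∀ k : ℕ, s₀ / 2 + (a * m : ℝ) * I ≠ -k) (h' : ∀ k : ℕ, s₀ / 2 + -((a * m : ℝ) * I) ≠ -k) :
    AnalyticAt ℂ (gammaPair a m) s₀ := by
  rw [gammaPair_eq]
  exact (analyticAt_const.mul (analyticAt_Gamma_half_add h)).mul (analyticAt_Gamma_half_add h')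

/-- The points `-2k + 2iam` with `k ≥ 0` and `m` integers. -/
def gammaPoles (a : ℝ) : Set ℂ := {s | ∃ (k : ℕ) (m : ℤ), s = -2 * (k : ℂ) + 2 * ((a * m : ℝ) * I)}

theorem analyticAt_gammaPair_of_notMem {a : ℝ} (m : ℤ) {s₀ : ℂ} (hs : s₀ ∉ gammaPoles a) :
    AnalyticAt ℂ (gammaPair a m) s₀ := by
  refine analyticAt_gammaPair (fun k hk => hs ⟨k, -m, ?_⟩) (fun k hk => hs ⟨k, m, ?_⟩)
  · push_cast at hk ⊢
    linear_combination 2 * hk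
  · push_cast at hk ⊢
    linear_combination 2 * hk

/-- This includes the poles: only finitely many terms can be singular there, and they do not affect
summability. -/
theorem summable_gammaPair {a : ℝ} (ha : 0 < a) (s : ℂ) : Summable fun m => gammaPair a m s := by
  obtain ⟨S, hS⟩ := exists_gammaPair_tail a ha s
  obtain ⟨T, -, hT⟩ := hS S subset_rfl
  exact hT.self_of_nhds.1

theorem analyticAt_tsum_gammaPair {a : ℝ} (ha : 0 < a) {s₀ : ℂ} (hs : s₀ ∉ gammaPoles a) :
    AnalyticAt ℂ (fun s => ∑' m, gammaPair a m s) s₀ := by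
  obtain ⟨S, hS⟩ := exists_gammaPair_tail a ha s₀
  obtain ⟨T, hT, hev⟩ := hS S subset_rfl
  have : AnalyticAt ℂ (fun s => ∑ m ∈ S, gammaPair a m s + T s) s₀ :=
    (Finset.analyticAt_fun_sum S fun m _ => analyticAt_gammaPair_of_notMem m hs).add hT
  exact this.congr (hev.mono fun s h => h.2.symm)

theorem meromorphicOrderAt_one_div_Gamma_neg_nat (k : ℕ) :
    meromorphicOrderAt (fun s => (Gamma s)⁻¹) (-k : ℂ) = ((1 : ℤ) : WithTop ℤ) := by
  have h : (fun s => (Gamma s)⁻¹) = Gamma⁻¹ := rfl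
  rw [h, meromorphicOrderAt_inv, meromorphicOrderAt_Gamma_neg_nat]
  rfl

/-- A Gamma argument at a pole is real; comparing imaginary parts leaves only the indices `m` and
`-m`. -/
theorem analyticAt_gammaPair_of_ne {a : ℝ} (ha : 0 < a) {k : ℕ} {m n : ℤ} {s₀ : ℂ}
    (hs : s₀ = -2 * (k : ℂ) + 2 * ((a * m : ℝ) * I)) (h : n ≠ m) (h' : n ≠ -m) :
    AnalyticAt ℂ (gammaPair a n) s₀ := by
  have key : ∀ (t : ℤ) (j : ℕ), s₀ / 2 + (a * t : ℝ) * I = -j → t = -m := by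
    intro t j hj
    have := congrArg Complex.im hj
    rw [hs] at this
    simp [mul_assoc] at this
    have h2 : a * ((m : ℝ) + t) = 0 := by linarith
    have h3 : (m : ℝ) + t = 0 := by
      rcases mul_eq_zero.1 h2 with h | h
      · exact absurd h ha.ne'
      · exact h
    have h4 : m + t = 0 := by exact_mod_cast h3
    omega
  refine analyticAt_gammaPair (fun j hj => h' (key n j hj)) (fun j hj => h ?_)
  have := key (-n) j (by rw [← hj]; push_cast; ring)
  omega

theorem meromorphicOrderAt_one_div_Gamma_mul_gammaPair_of_ne {a : ℝ} (ha : 0 < a) {k : ℕ} {m : ℤ}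
    (hm : m ≠ 0) {s₀ : ℂ} (hs : s₀ = -2 * (k : ℂ) + 2 * ((a * m : ℝ) * I)) :
    meromorphicOrderAt (fun s => (Gamma s)⁻¹ * gammaPair a m s) s₀ = ((-1 : ℤ) : WithTop ℤ) := by
  have him : (a * m : ℝ) ≠ 0 := mul_ne_zero ha.ne' (by exact_mod_cast hm)
  have h1 : ∀ j : ℕ, s₀ ≠ -j := by
    intro j hj
    have := congrArg Complex.im hj
    rw [hs] at this
    simp at this
    rcases this with h | h
    · exact ha.ne' h
    · exact hm h
  have h2 : ∀ j : ℕ, s₀ / 2 + (a * m : ℝ) * I ≠ -j := by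
    intro j hj
    have := congrArg Complex.im hj
    rw [hs] at this
    simp at this
    exact him (mul_eq_zero.2 (by simpa using this))
  have hc : (-1 : ℂ) ^ m ≠ 0 := zpow_ne_zero _ (by norm_num)
  have e : (fun s => (Gamma s)⁻¹ * gammaPair a m s) =
      (fun s => (Gamma s)⁻¹ * ((-1 : ℂ) ^ m * Gamma (s / 2 + (a * m : ℝ) * I))) *
        fun s => Gamma (s / 2 + -((a * m : ℝ) * I)) := by
    ext s
    simp [gammaPair_eq, mul_assoc]
  rw [e, meromorphicOrderAt_mul_of_ne_zero]
  · refine meromorphicOrderAt_Gamma_half_add _ _ k ?_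
    rw [hs]; ring
  · exact (analyticAt_one_div_Gamma _).mul (analyticAt_const.mul (analyticAt_Gamma_half_add h2))
  · exact mul_ne_zero (inv_ne_zero (Gamma_ne_zero h1)) (mul_ne_zero hc (Gamma_ne_zero h2))

theorem meromorphicOrderAt_one_div_Gamma_mul_gammaPair_zero (a : ℝ) (k : ℕ) :
    meromorphicOrderAt (fun s => (Gamma s)⁻¹ * gammaPair a 0 s) (-2 * (k : ℂ)) =
      ((-1 : ℤ) : WithTop ℤ) := by
  have e : (fun s => (Gamma s)⁻¹ * gammaPair a 0 s) =
      (fun s => (Gamma s)⁻¹) * ((fun s => Gamma (s / 2 + 0)) * fun s => Gamma (s / 2 + 0)) := by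
    ext s
    simp [gammaPair_eq]
  have hm : MeromorphicAt (fun s => Gamma (s / 2 + 0)) (-2 * (k : ℂ)) := by
    -- The order of a non-meromorphic function is `0` by convention, so order `-1` forces
    -- meromorphy.
    by_contra h
    have h1 := meromorphicOrderAt_of_not_meromorphicAt h
    rw [meromorphicOrderAt_Gamma_half_add 0 _ k (by ring)] at h1
    exact absurd h1 (by decide)
  have h2 : (-2 * (k : ℂ)) = -((2 * k : ℕ) : ℂ) := by push_cast; ring
  rw [e, meromorphicOrderAt_mul (analyticAt_one_div_Gamma _).meromorphicAt (hm.mul hm),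
    meromorphicOrderAt_mul hm hm, meromorphicOrderAt_Gamma_half_add 0 _ k (by ring), h2,
    meromorphicOrderAt_one_div_Gamma_neg_nat]
  rfl

theorem meromorphicOrderAt_one_div_Gamma_mul_tsum {a : ℝ} (ha : 0 < a) {s₀ : ℂ}
    (hs : s₀ ∈ gammaPoles a) :
    meromorphicOrderAt (fun s => (Gamma s)⁻¹ * ∑' m, gammaPair a m s) s₀ =
      ((-1 : ℤ) : WithTop ℤ) := by
  classical
  obtain ⟨k, m, hs⟩ := hs
  obtain ⟨S, hS⟩ := exists_gammaPair_tail a ha s₀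
  obtain ⟨T, hT, hev⟩ := hS (S ∪ {m, -m}) Finset.subset_union_left
  have hsub : ({m, -m} : Finset ℤ) ⊆ S ∪ {m, -m} := Finset.subset_union_right
  set R : ℂ → ℂ := fun s =>
    (Gamma s)⁻¹ * (∑ n ∈ (S ∪ {m, -m}) \ {m, -m}, gammaPair a n s + T s) with hR
  have hRa : AnalyticAt ℂ R s₀ := by
    refine (analyticAt_one_div_Gamma _).mul
      ((Finset.analyticAt_fun_sum _ fun n hn => ?_).add hT)
    simp only [Finset.mem_sdiff, Finset.mem_insert, Finset.mem_singleton, not_or] at hn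
    exact analyticAt_gammaPair_of_ne ha hs hn.2.1 hn.2.2
  -- `Q` carries the whole singularity and `R` is analytic. For `m = 0` the set `{m, -m}` has one
  -- element.
  set Q : ℂ → ℂ := fun s => (Gamma s)⁻¹ * ∑ n ∈ {m, -m}, gammaPair a n s with hQ
  have hcongr : (fun s => (Gamma s)⁻¹ * ∑' m, gammaPair a m s) =ᶠ[𝓝[≠] s₀] Q + R := by
    filter_upwards [mem_nhdsWithin_of_mem_nhds hev] with s h
    simp only [Pi.add_apply, hQ, hR]
    rw [h.2, ← Finset.sum_sdiff hsub]
    ring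
  have hQord : meromorphicOrderAt Q s₀ = ((-1 : ℤ) : WithTop ℤ) := by
    by_cases hm : m = 0
    · subst hm
      have h0 : s₀ = -2 * (k : ℂ) := by rw [hs]; simp
      rw [h0, ← meromorphicOrderAt_one_div_Gamma_mul_gammaPair_zero a k]
      simp [hQ]
    · have hne : m ≠ -m := by omega
      have e : Q = (fun _ => (2 : ℂ)) * fun s => (Gamma s)⁻¹ * gammaPair a m s := by
        ext s
        simp only [hQ, Pi.mul_apply, Finset.sum_pair hne, gammaPair_neg]
        ring
      rw [e, meromorphicOrderAt_mul_of_ne_zero analyticAt_const two_ne_zero,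
        meromorphicOrderAt_one_div_Gamma_mul_gammaPair_of_ne ha hm hs]
  rw [meromorphicOrderAt_congr hcongr, meromorphicOrderAt_add_eq_left_of_lt hRa.meromorphicAt,
    hQord]
  rw [hQord]
  exact lt_of_lt_of_le (by decide) hRa.meromorphicOrderAt_nonneg

end GammaSeries

/-! ### Poisson summation for powers of the hyperbolic secant. -/

section PoissonSech

open Filter Topology MeasureTheory
open scoped FourierTransform

theorem ofReal_cpow_eq_exp_log {x : ℝ} (hx : 0 < x) (a : ℂ) :
    (x : ℂ) ^ a = Complex.exp (a * (Real.log x : ℝ)) := by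
  rw [Complex.cpow_def_of_ne_zero (by exact_mod_cast hx.ne'), Complex.ofReal_log hx.le, mul_comm]

/-- The function `x ↦ (2 cosh (L (2x + 1))) ^ (-s)`. -/
noncomputable def sechPow (L : ℝ) (s : ℂ) (x : ℝ) : ℂ :=
  ((2 * Real.cosh (L * (2 * x + 1)) : ℝ) : ℂ) ^ (-s)

theorem sechPow_eq_exp (L : ℝ) (s : ℂ) (x : ℝ) :
    sechPow L s x = Complex.exp (-s * (Real.log (2 * Real.cosh (L * (2 * x + 1))) : ℝ)) :=
  ofReal_cpow_eq_exp_log (by positivity) _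

theorem continuous_sechPow (L : ℝ) (s : ℂ) : Continuous (sechPow L s) := by
  have h : Continuous fun x : ℝ => Real.log (2 * Real.cosh (L * (2 * x + 1))) :=
    Continuous.log (by fun_prop) fun x => by positivity
  simp_rw [funext (sechPow_eq_exp L s)]
  fun_prop

theorem sigmoid_two_mul (u : ℝ) :
    Real.sigmoid (2 * u) = Real.exp (u - Real.log (2 * Real.cosh u)) := by
  have hc : 0 < Real.cosh u := Real.cosh_pos u
  rw [Real.exp_sub, Real.exp_log (by positivity), Real.cosh_eq, Real.sigmoid_def,
    show -(2 * u) = -u + -u by ring, Real.exp_add]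
  have h : Real.exp u * Real.exp (-u) = 1 := by rw [← Real.exp_add]; simp
  have h1 := Real.exp_pos u
  have h2 := Real.exp_pos (-u)
  field_simp
  linear_combination (-Real.exp (-u)) * h

theorem one_sub_sigmoid_two_mul (u : ℝ) :
    1 - Real.sigmoid (2 * u) = Real.exp (-u - Real.log (2 * Real.cosh u)) := by
  rw [← Real.sigmoid_neg, show -(2 * u) = 2 * -u by ring, sigmoid_two_mul, Real.cosh_neg]

/-- Substitute `t = sigmoid (2u)` with `u = L (2x + 1)`: then `t = e^u / (2 cosh u)`, `1 - t =
e^(-u) / (2 cosh u)` and `dt = 4 L t (1 - t) dx`, which absorbs the `-1` in both exponents. -/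
theorem betaIntegral_eq_integral_sechPow {L : ℝ} (hL : 0 < L) (a b : ℂ) :
    Complex.betaIntegral a b =
      4 * L * ∫ x : ℝ, Complex.exp ((a - b) * (L * (2 * x + 1) : ℝ)) * sechPow L (a + b) x := by
  set φ : ℝ → ℝ := fun x => Real.sigmoid (2 * (L * (2 * x + 1))) with hφ
  have himg : φ '' Set.univ = Set.Ioo 0 1 := by
    rw [Set.image_univ, ← Real.range_sigmoid]
    refine Set.Subset.antisymm ?_ ?_
    · rintro _ ⟨x, rfl⟩
      exact ⟨_, rfl⟩
    · rintro _ ⟨y, rfl⟩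
      refine ⟨(y / (2 * L) - 1) / 2, ?_⟩
      simp only [hφ]
      congr 1
      field_simp
      ring
  have hderiv : ∀ x ∈ Set.univ, HasDerivWithinAt φ (4 * L * (φ x * (1 - φ x))) Set.univ x := by
    intro x _
    have h1 : HasDerivAt (fun x : ℝ => 2 * (L * (2 * x + 1))) (4 * L) x := by
      have := ((((hasDerivAt_id x).const_mul 2).add_const 1).const_mul L).const_mul 2
      exact this.congr_deriv (by ring)
    have := (Real.hasDerivAt_sigmoid (2 * (L * (2 * x + 1)))).comp x h1
    rw [mul_comm] at this
    exact this.hasDerivWithinAt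
  have hinj : Set.InjOn φ Set.univ := by
    intro x _ y _ h
    have h1 := Real.sigmoid_injective h
    have h2 : L * (2 * x + 1) = L * (2 * y + 1) := by linarith
    have h3 := mul_left_cancel₀ hL.ne' h2
    linarith
  rw [Complex.betaIntegral, intervalIntegral.integral_of_le zero_le_one,
    integral_Ioc_eq_integral_Ioo, ← himg,
    integral_image_eq_integral_abs_deriv_smul MeasurableSet.univ hderiv hinj,
    setIntegral_univ, ← integral_const_mul]
  refine integral_congr_ae (Eventually.of_forall fun x => ?_)
  simp only
  set u := L * (2 * x + 1) with hu
  set ℓ := Real.log (2 * Real.cosh u) with hl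
  have e1 : φ x = Real.exp (u - ℓ) := sigmoid_two_mul u
  have e2 : 1 - φ x = Real.exp (-u - ℓ) := one_sub_sigmoid_two_mul u
  have h1 : 0 < φ x := e1 ▸ Real.exp_pos _
  have h2 : 0 < 1 - φ x := e2 ▸ Real.exp_pos _
  have e3 : (1 : ℂ) - (φ x : ℂ) = ((1 - φ x : ℝ) : ℂ) := by push_cast; ring
  have e4 : (φ x : ℂ) ^ a = Complex.exp (a * (u - ℓ)) := by
    rw [ofReal_cpow_eq_exp_log h1, e1, Real.log_exp]; push_cast; rfl
  have e5 : ((1 - φ x : ℝ) : ℂ) ^ b = Complex.exp (b * (-u - ℓ)) := by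
    rw [ofReal_cpow_eq_exp_log h2, e2, Real.log_exp]; push_cast; rfl
  rw [abs_of_pos (by positivity), e3, Complex.cpow_sub _ _ (by exact_mod_cast h1.ne'),
    Complex.cpow_sub _ _ (by exact_mod_cast h2.ne'), Complex.cpow_one, Complex.cpow_one, e4, e5,
    sechPow_eq_exp, Complex.real_smul, ← hu, ← hl]
  have h1' : (φ x : ℂ) ≠ 0 := by exact_mod_cast h1.ne'
  have h2' : ((1 - φ x : ℝ) : ℂ) ≠ 0 := by exact_mod_cast h2.ne'
  have e6 : Complex.exp ((a - b) * (u : ℝ)) * Complex.exp (-(a + b) * (ℓ : ℝ)) =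
      Complex.exp (a * (u - ℓ)) * Complex.exp (b * (-u - ℓ)) := by
    rw [← Complex.exp_add, ← Complex.exp_add]
    congr 1
    ring
  rw [e6]
  rw [Complex.ofReal_mul, Complex.ofReal_mul, Complex.ofReal_mul]
  field_simp
  push_cast
  ring

theorem exp_neg_int_mul_pi_mul_I (m : ℤ) : Complex.exp (-(m * (Real.pi * Complex.I))) = (-1) ^ m := by
  rw [Complex.exp_neg, Complex.exp_int_mul, Complex.exp_pi_mul_I, ← inv_zpow, inv_neg, inv_one]

theorem fourier_sechPow {L : ℝ} (hL : 0 < L) {s : ℂ} (hs : 0 < s.re) (m : ℤ) :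
    𝓕 (sechPow L s) (m : ℝ) =
      (4 * L * Complex.Gamma s)⁻¹ * gammaPair (Real.pi / (2 * L)) m s := by
  set A := s / 2 - ((Real.pi / (2 * L) * m : ℝ) : ℂ) * Complex.I with hA
  set B := s / 2 + ((Real.pi / (2 * L) * m : ℝ) : ℂ) * Complex.I with hB
  have hre : (s / 2).re = s.re / 2 := by simp
  have hAr : 0 < A.re := by
    rw [hA, Complex.sub_re, Complex.re_ofReal_mul, hre]; simp; exact hs
  have hBr : 0 < B.re := by
    rw [hB, Complex.add_re, Complex.re_ofReal_mul, hre]; simp; exact hs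
  have hAB : A + B = s := by rw [hA, hB]; ring
  have hL' : (L : ℂ) ≠ 0 := by exact_mod_cast hL.ne'
  have hG : Complex.Gamma s ≠ 0 := Complex.Gamma_ne_zero_of_re_pos hs
  have h1 := Complex.Gamma_mul_Gamma_eq_betaIntegral hAr hBr
  rw [betaIntegral_eq_integral_sechPow hL, hAB] at h1
  -- Here `(A - B) L (2x + 1) = -2πimx - πim`; the first part is the Fourier kernel, the second
  -- gives `(-1) ^ m`.
  have h2 : (∫ x : ℝ, Complex.exp ((A - B) * (L * (2 * x + 1) : ℝ)) * sechPow L s x) =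
      (-1) ^ m * 𝓕 (sechPow L s) (m : ℝ) := by
    rw [Real.fourier_real_eq_integral_exp_smul, ← integral_const_mul]
    refine integral_congr_ae (Eventually.of_forall fun x => ?_)
    simp only [smul_eq_mul]
    rw [← mul_assoc, ← exp_neg_int_mul_pi_mul_I, ← Complex.exp_add]
    congr 2
    rw [hA, hB]
    push_cast
    field_simp
    ring
  have h3 : ((-1 : ℂ) ^ m) * (-1) ^ m = 1 := by
    rw [← mul_zpow]; simp
  rw [h2] at h1
  rw [gammaPair, ← hA, ← hB, mul_assoc ((-1 : ℂ) ^ m), mul_comm (Complex.Gamma B), h1]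
  field_simp
  linear_combination (-𝓕 (sechPow L s) (m : ℝ)) * h3

theorem norm_sechPow_le (L : ℝ) {s : ℂ} (hs : 0 < s.re) (x : ℝ) :
    ‖sechPow L s x‖ ≤ Real.exp (-s.re * |L * (2 * x + 1)|) := by
  set u := L * (2 * x + 1) with hu
  have hc : 0 < 2 * Real.cosh u := by positivity
  rw [sechPow, Complex.norm_cpow_eq_rpow_re_of_pos hc, Complex.neg_re, Real.rpow_def_of_pos hc,
    mul_comm]
  refine Real.exp_le_exp.2 ?_
  have h : |u| ≤ Real.log (2 * Real.cosh u) := by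
    rw [Real.le_log_iff_exp_le hc, ← Real.cosh_abs, Real.cosh_eq]
    linarith [Real.exp_pos (-|u|)]
  nlinarith

theorem sechPow_isBigO {L : ℝ} (hL : 0 < L) {s : ℂ} (hs : 0 < s.re) :
    sechPow L s =O[cocompact ℝ] fun x : ℝ => |x| ^ (-2 : ℝ) := by
  have h1 := (isLittleO_exp_neg_mul_rpow_atTop (a := 2 * L * s.re) (by positivity) (-2)).isBigO
  have h2 := h1.comp_tendsto (tendsto_norm_cocompact_atTop (E := ℝ))
  refine Asymptotics.IsBigO.trans ?_ h2
  -- The constant comes from `|2x + 1| ≥ 2|x| - 1`.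
  refine Asymptotics.IsBigO.of_bound (Real.exp (L * s.re)) (Eventually.of_forall fun x => ?_)
  simp only [Function.comp_apply, Real.norm_eq_abs, Real.abs_exp]
  refine (norm_sechPow_le L hs x).trans ?_
  rw [← Real.exp_add]
  refine Real.exp_le_exp.2 ?_
  rw [abs_mul, abs_of_pos hL]
  have h3 : 2 * |x| - 1 ≤ |2 * x + 1| := by
    have := abs_sub (2 * x + 1) 1
    rw [add_sub_cancel_right, abs_mul, abs_two, abs_one] at this
    linarith
  have h4 : 0 < s.re * L := by positivity
  nlinarith

theorem summable_sechPow {L : ℝ} (hL : 0 < L) {s : ℂ} (hs : 0 < s.re) :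
    Summable fun n : ℤ => sechPow L s n :=
  summable_of_isBigO (Real.summable_abs_int_rpow one_lt_two)
    ((sechPow_isBigO hL hs).comp_tendsto Int.tendsto_coe_cofinite)

theorem tsum_sechPow {L : ℝ} (hL : 0 < L) {s : ℂ} (hs : 0 < s.re) :
    ∑' n : ℤ, sechPow L s n =
      (4 * L * Complex.Gamma s)⁻¹ * ∑' m : ℤ, gammaPair (Real.pi / (2 * L)) m s := by
  have hF : Summable fun m : ℤ => 𝓕 (sechPow L s) (m : ℝ) := by
    simp_rw [fourier_sechPow hL hs]
    exact (summable_gammaPair (by positivity) s).mul_left _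
  have h := Real.tsum_eq_tsum_fourier_of_rpow_decay_of_summable (continuous_sechPow L s)
    one_lt_two (sechPow_isBigO hL hs) hF 0
  simp only [zero_add, QuotientAddGroup.mk_zero, fourier_eval_zero, mul_one] at h
  rw [h, ← tsum_mul_left]
  exact tsum_congr fun m => fourier_sechPow hL hs m

theorem sechPow_neg_add_one (L : ℝ) (s : ℂ) (n : ℕ) :
    sechPow L s ((-((n : ℤ) + 1) : ℤ) : ℝ) = sechPow L s n := by
  unfold sechPow
  rw [← Real.cosh_neg]
  congr 4
  push_cast
  ring

theorem hasSum_sechPow_nat {L : ℝ} (hL : 0 < L) {s : ℂ} (hs : 0 < s.re) :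
    HasSum (fun n : ℕ => sechPow L s n)
      ((8 * L * Complex.Gamma s)⁻¹ * ∑' m : ℤ, gammaPair (Real.pi / (2 * L)) m s) := by
  have hsum : Summable fun n : ℕ => sechPow L s n := by
    have := (summable_sechPow hL hs).comp_injective (i := ((↑) : ℕ → ℤ)) Nat.cast_injective
    simpa [Function.comp_def] using this
  -- The two halves of the sum over `ℤ` agree, which turns the factor `4` into `8`.
  have h := HasSum.of_nat_of_neg_add_one (f := fun n : ℤ => sechPow L s n)
    (by simpa using hsum.hasSum) (by simpa only [sechPow_neg_add_one] using hsum.hasSum)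
  have h1 := h.tsum_eq
  rw [tsum_sechPow hL hs] at h1
  convert hsum.hasSum using 1
  have hL' : (L : ℂ) ≠ 0 := by exact_mod_cast hL.ne'
  have hG : Complex.Gamma s ≠ 0 := Complex.Gamma_ne_zero_of_re_pos hs
  field_simp at h1 ⊢
  linear_combination h1

end PoissonSech

/-! ### Trace and norm in the real quadratic field. -/

section RealQuadratic

/-- The element `√D` of `ℚ(√D)`. -/
noncomputable def sqrtGen (D : ℕ) : QSqrt D :=
  IntermediateField.AdjoinSimple.gen ℚ (Real.sqrt (D : ℝ))

theorem coe_sqrtGen (D : ℕ) : (sqrtGen D : ℝ) = Real.sqrt D :=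
  IntermediateField.AdjoinSimple.coe_gen ℚ _

theorem sqrtGen_mul_self (D : ℕ) : sqrtGen D * sqrtGen D = algebraMap ℚ (QSqrt D) D := by
  apply Subtype.ext
  change (sqrtGen D : ℝ) * (sqrtGen D : ℝ) = _
  rw [coe_sqrtGen, Real.mul_self_sqrt D.cast_nonneg]
  simp

theorem irrational_sqrt_of_squarefree {D : ℕ} (hD : 1 < D) (hsq : Squarefree D) :
    Irrational (Real.sqrt D) := by
  rw [irrational_sqrt_natCast_iff]
  rintro ⟨r, hr⟩
  have h1 : IsUnit r := hsq r ⟨1, by omega⟩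
  rw [Nat.isUnit_iff] at h1
  subst h1
  omega

open Polynomial in
theorem natDegree_minpoly_sqrt {D : ℕ} (hirr : Irrational (Real.sqrt D)) :
    (minpoly ℚ (Real.sqrt (D : ℝ))).natDegree = 2 := by
  have hirred : Irreducible (X ^ 2 - C (D : ℚ) : ℚ[X]) := by
    rw [X_pow_sub_C_irreducible_iff_of_prime Nat.prime_two]
    intro b hb
    apply hirr
    have h2 : ((b : ℝ)) ^ 2 = D := by exact_mod_cast hb
    refine ⟨|b|, ?_⟩
    rw [← h2, Real.sqrt_sq_eq_abs]
    push_cast; rfl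
  have h := minpoly.eq_of_irreducible_of_monic (x := Real.sqrt (D : ℝ)) hirred
    (by simp [Real.sq_sqrt]) (monic_X_pow_sub_C _ two_ne_zero)
  rw [← h, natDegree_X_pow_sub_C]

theorem isIntegral_sqrt (D : ℕ) : IsIntegral ℚ (Real.sqrt (D : ℝ)) :=
  IsIntegral.of_pow two_pos (by
    rw [Real.sq_sqrt D.cast_nonneg]
    exact_mod_cast isIntegral_algebraMap (R := ℚ) (A := ℝ) (x := (D : ℚ)))

theorem exists_basis {D : ℕ} (hirr : Irrational (Real.sqrt D)) :
    ∃ b : Module.Basis (Fin 2) ℚ (QSqrt D), b 0 = 1 ∧ b 1 = sqrtGen D := by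
  let pb := IntermediateField.adjoin.powerBasis (isIntegral_sqrt D)
  have hdim : pb.dim = 2 := natDegree_minpoly_sqrt hirr
  refine ⟨pb.basis.reindex (finCongr hdim), ?_, ?_⟩
  · simp
  · simp [pb, sqrtGen]

theorem exists_eq_add_mul_sqrtGen {D : ℕ} (hirr : Irrational (Real.sqrt D)) (x : QSqrt D) :
    ∃ a b : ℚ, x = algebraMap ℚ (QSqrt D) a + algebraMap ℚ (QSqrt D) b * sqrtGen D := by
  obtain ⟨B, h0, h1⟩ := exists_basis hirr
  refine ⟨B.repr x 0, B.repr x 1, ?_⟩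
  conv_lhs => rw [← B.sum_repr x]
  rw [Fin.sum_univ_two, h0, h1, Algebra.smul_def, Algebra.smul_def, mul_one]

theorem leftMulMatrix_add_mul_sqrtGen {D : ℕ} {B : Module.Basis (Fin 2) ℚ (QSqrt D)}
    (h0 : B 0 = 1) (h1 : B 1 = sqrtGen D) (a b : ℚ) :
    Algebra.leftMulMatrix B
      (algebraMap ℚ (QSqrt D) a + algebraMap ℚ (QSqrt D) b * sqrtGen D) =
      !![a, b * D; b, a] := by
  have e0 : (algebraMap ℚ (QSqrt D) a + algebraMap ℚ (QSqrt D) b * sqrtGen D) * B 0 =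
      a • B 0 + b • B 1 := by
    rw [h0, h1, Algebra.smul_def, Algebra.smul_def]; ring
  have e1 : (algebraMap ℚ (QSqrt D) a + algebraMap ℚ (QSqrt D) b * sqrtGen D) * B 1 =
      (b * D) • B 0 + a • B 1 := by
    rw [h0, h1, Algebra.smul_def, Algebra.smul_def, map_mul]
    linear_combination (algebraMap ℚ (QSqrt D) b) * sqrtGen_mul_self D
  ext i j
  rw [Algebra.leftMulMatrix_eq_repr_mul]
  fin_cases j
  · simp only [Fin.zero_eta, e0]
    fin_cases i <;> simp
  · simp only [Fin.mk_one, e1]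
    fin_cases i <;> simp

theorem trace_add_mul_sqrtGen {D : ℕ} (hirr : Irrational (Real.sqrt D)) (a b : ℚ) :
    Algebra.trace ℚ (QSqrt D)
      (algebraMap ℚ (QSqrt D) a + algebraMap ℚ (QSqrt D) b * sqrtGen D) = 2 * a := by
  obtain ⟨B, h0, h1⟩ := exists_basis hirr
  rw [Algebra.trace_eq_matrix_trace B, leftMulMatrix_add_mul_sqrtGen h0 h1,
    Matrix.trace_fin_two_of]
  ring

theorem norm_add_mul_sqrtGen {D : ℕ} (hirr : Irrational (Real.sqrt D)) (a b : ℚ) :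
    Algebra.norm ℚ
      (algebraMap ℚ (QSqrt D) a + algebraMap ℚ (QSqrt D) b * sqrtGen D) = a ^ 2 - D * b ^ 2 := by
  obtain ⟨B, h0, h1⟩ := exists_basis hirr
  rw [Algebra.norm_eq_matrix_det B, leftMulMatrix_add_mul_sqrtGen h0 h1, Matrix.det_fin_two_of]
  ring

/-- Tracks a power together with its conjugate, with no need for the Galois automorphism. -/
theorem exists_pow_eq (D : ℕ) (a b : ℚ) (n : ℕ) :
    ∃ a' b' : ℚ, ((a : ℝ) + b * Real.sqrt D) ^ n = a' + b' * Real.sqrt D ∧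
      ((a : ℝ) - b * Real.sqrt D) ^ n = a' - b' * Real.sqrt D := by
  have hD : Real.sqrt D * Real.sqrt D = D := Real.mul_self_sqrt D.cast_nonneg
  induction n with
  | zero => exact ⟨1, 0, by simp, by simp⟩
  | succ n ih =>
    obtain ⟨a', b', h1, h2⟩ := ih
    refine ⟨a' * a + D * b' * b, a' * b + b' * a, ?_, ?_⟩
    · rw [pow_succ, h1]; push_cast; linear_combination (b' * b : ℝ) * hD
    · rw [pow_succ, h2]; push_cast; linear_combination (b' * b : ℝ) * hD

theorem sqrt_qOf_eq (D : ℕ) :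
    ∃ c : ℚ, 0 < c ∧ Real.sqrt (qOf D) = c * Real.sqrt D := by
  unfold qOf
  split_ifs
  · exact ⟨1, one_pos, by simp⟩
  · refine ⟨2, two_pos, ?_⟩
    push_cast
    rw [Real.sqrt_mul (by norm_num), show (4 : ℝ) = 2 ^ 2 by norm_num,
      Real.sqrt_sq (by norm_num)]

theorem coe_eq_add_mul_sqrt {D : ℕ} (a b : ℚ) :
    ((algebraMap ℚ (QSqrt D) a + algebraMap ℚ (QSqrt D) b * sqrtGen D : QSqrt D) : ℝ) =
      a + b * Real.sqrt D := by
  change (a : ℝ) + (b : ℝ) * (sqrtGen D : ℝ) = _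
  rw [coe_sqrtGen]

theorem fibD_odd {D : ℕ} (hD : 1 < D) (hsq : Squarefree D) (ε : (𝓞 (QSqrt D))ˣ)
    (hN : Algebra.norm ℚ (unitToField ε) = -1) (hε : 1 < unitToReal ε) (n : ℕ) :
    ((fibD ε (2 * n + 1) : ℚ) : ℝ) =
      2 * Real.cosh (Real.log (unitToReal ε) * (2 * n + 1)) / Real.sqrt (qOf D) := by
  have hirr := irrational_sqrt_of_squarefree hD hsq
  have hDpos : 0 < Real.sqrt D := Real.sqrt_pos.2 (by exact_mod_cast (by omega : 0 < D))
  have hDD : Real.sqrt D * Real.sqrt D = D := Real.mul_self_sqrt D.cast_nonneg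
  obtain ⟨a, b, hab⟩ := exists_eq_add_mul_sqrtGen hirr (unitToField ε)
  obtain ⟨c, hc, hcq⟩ := sqrt_qOf_eq D
  have hcR : (0 : ℝ) < c := by exact_mod_cast hc
  rw [hab, norm_add_mul_sqrtGen hirr] at hN
  have hNR : (a : ℝ) ^ 2 - D * b ^ 2 = -1 := by exact_mod_cast hN
  have hreal : unitToReal ε = a + b * Real.sqrt D := by
    rw [unitToReal, hab, coe_eq_add_mul_sqrt]
  have hpos : 0 < unitToReal ε := by linarith
  -- The norm `-1` says that `ε` times its conjugate is `-1`.
  have hconj : (a : ℝ) - b * Real.sqrt D = -(unitToReal ε)⁻¹ := by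
    rw [eq_neg_iff_add_eq_zero, ← mul_left_inj' hpos.ne', zero_mul, add_mul,
      inv_mul_cancel₀ hpos.ne', hreal]
    linear_combination hNR - (b : ℝ) ^ 2 * hDD
  obtain ⟨a', b', h1, h2⟩ := exists_pow_eq D a b (2 * n + 1)
  rw [← hreal] at h1
  rw [hconj, Odd.neg_pow ⟨n, rfl⟩] at h2
  -- Dividing by `√q = c √D` exchanges the coordinates, so the trace reads off `b'`; oddness of the
  -- exponent gives `2 b' √D = ε^k + ε^(-k)`.
  have hmem : unitToField ε ^ (2 * n + 1) / sqrtQ D =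
      algebraMap ℚ (QSqrt D) (b' / c) + algebraMap ℚ (QSqrt D) (a' / (c * D)) * sqrtGen D := by
    apply Subtype.ext
    rw [coe_eq_add_mul_sqrt]
    change unitToReal ε ^ (2 * n + 1) / Real.sqrt (qOf D) = _
    rw [h1, hcq]
    push_cast
    have hD0 : (D : ℝ) ≠ 0 := by exact_mod_cast (by omega : D ≠ 0)
    field_simp
    linear_combination (-(a' : ℝ)) * hDD
  rw [fibD, hmem, trace_add_mul_sqrtGen hirr, hcq, Real.cosh_eq]
  have e1 : Real.exp (Real.log (unitToReal ε) * (2 * n + 1)) = unitToReal ε ^ (2 * n + 1) := by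
    rw [← Real.rpow_def_of_pos hpos, ← Real.rpow_natCast]; push_cast; rfl
  rw [Real.exp_neg, e1, ← inv_pow]
  have hsum : unitToReal ε ^ (2 * n + 1) + (unitToReal ε)⁻¹ ^ (2 * n + 1) =
      2 * b' * Real.sqrt D := by linarith
  rw [hsum]
  push_cast
  field_simp

end RealQuadratic

/-! ### Assembly of the continuation. -/

theorem gammaTerm_eq {D : ℕ} (ε : (𝓞 (QSqrt D))ˣ) (s : ℂ) (m : ℤ) :
    gammaTerm ε s m = gammaPair (Real.pi / (2 * Real.log (unitToReal ε))) m s := by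
  have e : (Real.pi * Complex.I * m / (2 * (Real.log (unitToReal ε) : ℂ))) =
      ((Real.pi / (2 * Real.log (unitToReal ε)) * m : ℝ) : ℂ) * Complex.I := by
    push_cast; ring
  rw [gammaTerm, gammaPair, e]

theorem poleSet_eq {D : ℕ} (ε : (𝓞 (QSqrt D))ˣ) :
    poleSet ε = gammaPoles (Real.pi / (2 * Real.log (unitToReal ε))) := by
  ext s
  have e : ∀ m : ℤ, Real.pi * Complex.I * m / (Real.log (unitToReal ε) : ℂ) =
      2 * (((Real.pi / (2 * Real.log (unitToReal ε)) * m : ℝ) : ℂ) * Complex.I) := by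
    intro m; push_cast; ring
  simp only [poleSet, gammaPoles, Set.mem_ofPred_eq, e]

theorem oddZetaTerm_eq {D : ℕ} (hD : 1 < D) (hsq : Squarefree D) (ε : (𝓞 (QSqrt D))ˣ)
    (hN : Algebra.norm ℚ (unitToField ε) = -1) (hε : 1 < unitToReal ε) (s : ℂ) (n : ℕ) :
    oddZetaTerm ε s n =
      (qOf D : ℂ) ^ (s / 2) * sechPow (Real.log (unitToReal ε)) s n := by
  have hq : 0 < qOf D := by unfold qOf; split_ifs <;> omega
  have hqR : (0 : ℝ) < qOf D := by exact_mod_cast hq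
  set c := 2 * Real.cosh (Real.log (unitToReal ε) * (2 * n + 1)) with hc
  have hc0 : 0 < c := by positivity
  have hF : ((fibD ε (2 * n + 1) : ℚ) : ℂ) = ((c / Real.sqrt (qOf D) : ℝ) : ℂ) := by
    rw [← fibD_odd hD hsq ε hN hε n]; push_cast; rfl
  have e1 : ((c / Real.sqrt (qOf D) : ℝ) : ℂ) ^ s =
      Complex.exp (s * (Real.log (c / Real.sqrt (qOf D)) : ℝ)) :=
    ofReal_cpow_eq_exp_log (by positivity) s
  have e2 : (qOf D : ℂ) ^ (s / 2) = Complex.exp (s / 2 * (Real.log (qOf D) : ℝ)) := by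
    rw [← ofReal_cpow_eq_exp_log hqR]; push_cast; rfl
  rw [oddZetaTerm, hF, e1, e2, sechPow_eq_exp, ← hc, ← Complex.exp_add, one_div,
    ← Complex.exp_neg, Real.log_div hc0.ne' (by positivity), Real.log_sqrt hqR.le]
  congr 1
  push_cast
  ring

theorem theorem4p2 (D : ℕ) (hD : 1 < D) (hsq : Squarefree D)
    (ε : (𝓞 (QSqrt D))ˣ) (hε : IsFundamentalUnit ε)
    (hN : Algebra.norm ℚ (unitToField ε) = -1) :
    ∃ Z : ℂ → ℂ,
      MeromorphicOn Z Set.univ ∧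
      (∀ s : ℂ, 0 < s.re → Summable (oddZetaTerm ε s) ∧ Z s = oddZetaSeries ε s) ∧
      (∀ s : ℂ, s ∉ poleSet ε →
        AnalyticAt ℂ Z s ∧
        Summable (gammaTerm ε s) ∧
        Z s = (qOf D : ℂ) ^ (s / 2)
            / (8 * Complex.Gamma s * (Real.log (unitToReal ε) : ℂ))
            * ∑' m : ℤ, gammaTerm ε s m) ∧
      (∀ s ∈ poleSet ε, meromorphicOrderAt Z s = ((-1 : ℤ) : WithTop ℤ)) := by
  have hε1 := hε.1
  set L := Real.log (unitToReal ε) with hL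
  have hLpos : 0 < L := Real.log_pos hε1
  have hL0 : (L : ℂ) ≠ 0 := by exact_mod_cast hLpos.ne'
  set a := Real.pi / (2 * L) with ha
  have hapos : 0 < a := by positivity
  have hq : (qOf D : ℂ) ≠ 0 := by
    have : qOf D ≠ 0 := by unfold qOf; split_ifs <;> omega
    exact_mod_cast this
  -- Defined by the formula everywhere. At non-positive integers `Complex.Gamma` takes the value
  -- `0`, and division by zero then gives `0`, matching the entire function `1/Γ`.
  set Z : ℂ → ℂ := fun s => (qOf D : ℂ) ^ (s / 2)
    / (8 * Complex.Gamma s * (L : ℂ)) * ∑' m : ℤ, gammaTerm ε s m with hZ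
  -- An entire factor without zeros, so it does not change the order at any point.
  set C : ℂ → ℂ := fun s => (qOf D : ℂ) ^ (s / 2) / (8 * L) with hC
  have hCd : Differentiable ℂ C := fun s =>
    ((differentiableAt_id.div_const 2).const_cpow (Or.inl hq)).div_const _
  have hC0 : ∀ s, C s ≠ 0 := fun s =>
    div_ne_zero (by simp [Complex.cpow_eq_zero_iff, hq])
      (mul_ne_zero (by norm_num) hL0)
  have hterm : ∀ s, gammaTerm ε s = fun m => gammaPair a m s := fun s =>
    funext fun m => gammaTerm_eq ε s m
  have hZC : Z = C * fun s => (Complex.Gamma s)⁻¹ * ∑' m, gammaPair a m s := by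
    ext s
    simp only [hZ, hC, Pi.mul_apply, hterm, div_eq_mul_inv, mul_inv]
    ring
  have hpole : poleSet ε = gammaPoles a := poleSet_eq ε
  have han : ∀ s ∉ poleSet ε, AnalyticAt ℂ Z s := by
    intro s hs
    rw [hpole] at hs
    rw [hZC]
    exact (hCd.analyticAt s).mul
      ((analyticAt_one_div_Gamma s).mul (analyticAt_tsum_gammaPair hapos hs))
  have hord : ∀ s ∈ poleSet ε, meromorphicOrderAt Z s = ((-1 : ℤ) : WithTop ℤ) := by
    intro s hs
    rw [hpole] at hs
    rw [hZC, meromorphicOrderAt_mul_of_ne_zero (hCd.analyticAt s) (hC0 s),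
      meromorphicOrderAt_one_div_Gamma_mul_tsum hapos hs]
  refine ⟨Z, fun s _ => ?_, fun s hs => ?_, fun s hs => ⟨han s hs, ?_, rfl⟩, hord⟩
  · by_cases hs : s ∈ poleSet ε
    · by_contra h
      have h1 := meromorphicOrderAt_of_not_meromorphicAt h
      rw [hord s hs] at h1
      exact absurd h1 (by decide)
    · exact (han s hs).meromorphicAt
  · have h := (hasSum_sechPow_nat hLpos hs).mul_left ((qOf D : ℂ) ^ (s / 2))
    have h' : HasSum (oddZetaTerm ε s) (Z s) := by
      have e : oddZetaTerm ε s = fun n : ℕ => (qOf D : ℂ) ^ (s / 2) * sechPow L s n :=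
        funext fun n => oddZetaTerm_eq hD hsq ε hN hε1 s n
      rw [e]
      have e' : Z s = (qOf D : ℂ) ^ (s / 2) *
          ((8 * L * Complex.Gamma s)⁻¹ * ∑' m : ℤ, gammaPair a m s) := by
        simp only [hZ, hterm, div_eq_mul_inv, mul_inv]
        ring
      rw [e']
      exact h
    exact ⟨h'.summable, h'.tsum_eq.symm⟩
  · rw [hterm]
    exact summable_gammaPair hapos s
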